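/- Let $A<B$ and let $\gamma_1,\gamma_2:[A,B]\to\mathbb R$ be continuous functions such that $d(x,y):=\gamma_1(x)\gamma_2(y)-\gamma_1(y)\gamma_2(x)\neq 0$ for all distinct $x,y\in[A,B]$ and $1\in\operatorname{span}\{\gamma_1,\gamma_2\}$ on $[A,B]$. For $d\ge 0$ let $\pi_d(\gamma_1,\gamma_2)=\operatorname{span}\{\gamma_1^{d-k}\gamma_2^k\}_{k=0}^d$. Let $D=D_{\gamma_1,\gamma_2}$ be the generalized derivative $Df(x_0)=\lim_{x\to x_0}\frac{f(x)-f(x_0)}{d(x_0,x)}$ (with $x\in[A,B]$, $x\ne x_0$), and write $D\,d(a,x)$ for the generalized derivative at $a$ of $s\mapsto d(s,x)$. The divided difference $f[x_0,\dots,x_n]$ is defined recursively by $f[x_0]=f(x_0)$ and $$f[x_0,\dots,x_n]=\frac{f[x_0,\dots,x_{n-2},x_n]-f[x_0,\dots,x_{n-1}]}{d(x_{n-1},x_n)}$$ for distinct nodes. When nodes coincide it is extended as follows: if all nodes are equal, $f[x_0,\dots,x_0]=D^nf(x_0)/n!$; otherwise $x_{n-1}$ in the recursion is replaced by $x_p$,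 where $p$ is the largest index with $x_p\ne x_n$, that is, $f[x_0,\dots,x_n]$ is the difference of the divided differences on the nodes without $x_p$ and without $x_n$, divided by $d(x_p,x_n)$. A (homogeneous) blossom with $k$ arguments of a function $F$ on $[A,B]$ is a symmetric multilinear function $g:(\mathbb R^2)^k\to\mathbb R$ with $g((\gamma_1(x),\gamma_2(x)),\dots,(\gamma_1(x),\gamma_2(x)))=F(x)$ for all $x\in[A,B]$. Let $1\le n\le d+1$ and $G\in\pi_d(\gamma_1,\gamma_2)$. Then $DG,\dots,D^{n-1}G$ exist on $[A,B]$, $D\,d(a,x)$ exists for all $a,x\in[A,B]$, the function $D^{n-1}G$ has exactly one blossom $g^{(n-1)}$ with $d-n+1$ arguments, and for all $\varepsilon_1,\dots,\varepsilon_n\in[A,B]$, with $(u_i,v_i)=(\gamma_1(\varepsilon_i),\gamma_2(\varepsilon_i))$, and all $a,x\in[A,B]$, $$\Big\{\big(D\,d(a,\cdot)\big)^{n-1}G\Big\}[\varepsilon_1,\dots,\varepsilon_n]=\big(D\,d(a,x)\big)^{n-1}\,\frac{(d-n+1)!}{d!}\sum_{1\le j_1\le\dots\le j_{d-n+1}\le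 n}g^{(n-1)}\big((u_{j_1},v_{j_1}),\dots,(u_{j_{d-n+1}},v_{j_{d-n+1}})\big),$$ and likewise $$G[\varepsilon_1,\dots,\varepsilon_n]=\frac{(d-n+1)!}{d!}\sum_{1\le j_1\le\dots\le j_{d-n+1}\le n}g^{(n-1)}\big((u_{j_1},v_{j_1}),\dots,(u_{j_{d-n+1}},v_{j_{d-n+1}})\big).$$ -/

import Mathlib

open Set Filter Topology

noncomputable section

/-- The bracket `d(x, y) = γ₁(x) γ₂(y) - γ₁(y) γ₂(x)` of the planar curve `(γ₁, γ₂)`. -/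
def bracket (γ₁ γ₂ : ℝ → ℝ) (x y : ℝ) : ℝ :=
  γ₁ x * γ₂ y - γ₁ y * γ₂ x

/-- The functions that agree on `[A, B]` with a member of
`span {γ₁ ^ (d - k) * γ₂ ^ k | 0 ≤ k ≤ d}`. -/
def piSpace (γ₁ γ₂ : ℝ → ℝ) (A B : ℝ) (d : ℕ) : Set (ℝ → ℝ) :=
  {G | ∃ H ∈ Submodule.span ℝ
      (Set.range fun k : Fin (d + 1) => fun x : ℝ => γ₁ x ^ (d - (k : ℕ)) * γ₂ x ^ (k : ℕ)),
    Set.EqOn G H (Set.Icc A B)}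

/-- `f` has the generalized derivative `L` at `x₀`: `(f(x) - f(x₀)) / d(x₀, x) → L` as `x → x₀`
with `x ∈ [A, B]`, `x ≠ x₀`. -/
def HasGenDerivAt (γ₁ γ₂ : ℝ → ℝ) (A B : ℝ) (f : ℝ → ℝ) (L x₀ : ℝ) : Prop :=
  Tendsto (fun x => (f x - f x₀) / bracket γ₁ γ₂ x₀ x) (𝓝[Set.Icc A B \ {x₀}] x₀) (𝓝 L)

/-- The generalized derivative operator `D_{γ₁,γ₂}` on the interval `[A, B]` (meaningful where
the limit exists). -/
def genDeriv (γ₁ γ₂ : ℝ → ℝ) (A B : ℝ) (f : ℝ → ℝ) (x₀ : ℝ) : ℝ :=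
  limUnder (𝓝[Set.Icc A B \ {x₀}] x₀) (fun x => (f x - f x₀) / bracket γ₁ γ₂ x₀ x)

/-- The non-polynomial divided difference `f[x₀, …, xₙ]`.
If all nodes coincide it is `Dⁿ f(x₀) / n!`. Otherwise, with `p` the largest index such that
`x_p ≠ x_n`, it is `(f[nodes without x_p] - f[nodes without x_n]) / d(x_p, x_n)`. For distinct
nodes `p = n - 1`, and this is the recursion
`f[x₀,…,xₙ] = (f[x₀,…,xₙ₋₂,xₙ] - f[x₀,…,xₙ₋₁]) / d(xₙ₋₁,xₙ)`. -/
def divDiff (γ₁ γ₂ : ℝ → ℝ) (A B : ℝ) (f : ℝ → ℝ) : (n : ℕ) → (Fin (n + 1) → ℝ) → ℝ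
  | 0, x => f (x 0)
  | n + 1, x =>
    if h : (Finset.univ.filter fun i => x i ≠ x (Fin.last (n + 1))).Nonempty then
      (divDiff γ₁ γ₂ A B f n
          (fun i => x (((Finset.univ.filter fun i => x i ≠ x (Fin.last (n + 1))).max' h).succAbove i))
        - divDiff γ₁ γ₂ A B f n (fun i => x i.castSucc))
        / bracket γ₁ γ₂ (x ((Finset.univ.filter fun i => x i ≠ x (Fin.last (n + 1))).max' h))
            (x (Fin.last (n + 1)))
    else (genDeriv γ₁ γ₂ A B)^[n + 1] f (x 0) / ((n + 1).factorial : ℝ)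

/-- `g` is a homogeneous (multilinear) blossom of `F` with `k` arguments: a symmetric multilinear
function of `k` pairs that reduces to `F` along the `(γ₁, γ₂)`-diagonal. -/
structure IsBlossom (γ₁ γ₂ : ℝ → ℝ) (A B : ℝ) (k : ℕ) (F : ℝ → ℝ)
    (g : MultilinearMap ℝ (fun _ : Fin k => ℝ × ℝ) ℝ) : Prop where
  symm : ∀ (σ : Equiv.Perm (Fin k)) (v : Fin k → ℝ × ℝ), g (fun i => v (σ i)) = g v
  diag : ∀ x ∈ Set.Icc A B, g (fun _ => (γ₁ x, γ₂ x)) = F x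

open Classical in
/-- The sum of `g((u_{j₁}, v_{j₁}), …, (u_{j_k}, v_{j_k}))` over all index tuples
`j₁ ≤ … ≤ j_k`, where `(uᵢ, vᵢ) = (γ₁(εᵢ), γ₂(εᵢ))`. -/
def blossomSum (γ₁ γ₂ : ℝ → ℝ) {n k : ℕ} (ε : Fin n → ℝ)
    (g : MultilinearMap ℝ (fun _ : Fin k => ℝ × ℝ) ℝ) : ℝ :=
  ∑ j : {j : Fin k → Fin n // Monotone j},
    g (fun i => (γ₁ (ε (j.1 i)), γ₂ (ε (j.1 i))))

end

/-! By polarization `G` is a combination of powers `ℓ ^ d` with `ℓ = γ₁ + c γ₂`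
(`monomial_mem_span_pow`), so everything reduces to one power. Since `α γ₁ + β γ₂ = 1`, increments
of `ℓ` are `r = c α - β` times the bracket: `ℓ` behaves like an affine function of slope `r`. Hence
`D ^ m (ℓ ^ d)` is `d! / (d - m)! * r ^ m * ℓ ^ (d - m)`, and the divided difference of `ℓ ^ d` at
`m + 1` nodes is `r ^ m` times the complete homogeneous sum of degree `d - m` in the node values
(`divDiff_sum_pow`). The blossom of `ℓ ^ k` is a product of linear forms, whose sum over monotone
tuples is that same homogeneous sum. The factorials cancel, and `D d(a, x) = -1` turns the first
formula into a rescaled second one.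

Uniqueness holds because the curve has infinitely many points on a line that avoids the origin. -/

/-! ### Complete homogeneous sums. -/

/-- The complete homogeneous symmetric sum of degree `k` of the family `x`. -/
def completeHomogeneous {σ : Type*} [Fintype σ] [DecidableEq σ] (k : ℕ) (x : σ → ℝ) : ℝ :=
  ∑ s : Sym σ k, ((s : Multiset σ).map x).prod

theorem completeHomogeneous_comp_equiv {σ τ : Type*} [Fintype σ] [DecidableEq σ] [Fintype τ]
    [DecidableEq τ] (e : σ ≃ τ) (k : ℕ) (x : τ → ℝ) :
    completeHomogeneous k (x ∘ e) = completeHomogeneous k x := by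
  refine Fintype.sum_equiv (Sym.equivCongr e) _ _ fun s => ?_
  simp [Sym.equivCongr, Multiset.map_map]

/-- Multisets are split by whether they contain `none`. -/
theorem completeHomogeneous_option {σ : Type*} [Fintype σ] [DecidableEq σ] (k : ℕ)
    (x : Option σ → ℝ) :
    completeHomogeneous (k + 1) x
      = x none * completeHomogeneous k x + completeHomogeneous (k + 1) (x ∘ some) := by
  rw [completeHomogeneous, ← Equiv.sum_comp symOptionSuccEquiv.symm, Fintype.sum_sum_type]
  congr 1
  · rw [completeHomogeneous, Finset.mul_sum]
    refine Finset.sum_congr rfl fun s _ => ?_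
    change (Multiset.map x (none ::ₘ (s : Multiset (Option σ)))).prod = _
    simp
  · refine Finset.sum_congr rfl fun s _ => ?_
    simp [symOptionSuccEquiv, Multiset.map_map]

theorem completeHomogeneous_succAbove {n : ℕ} (k : ℕ) (x : Fin (n + 1) → ℝ) (p : Fin (n + 1)) :
    completeHomogeneous (k + 1) x
      = x p * completeHomogeneous k x + completeHomogeneous (k + 1) (fun i => x (p.succAbove i)) := by
  have h := completeHomogeneous_option k (x ∘ (finSuccEquiv' p).symm)
  simp only [completeHomogeneous_comp_equiv] at h
  simpa [Function.comp_def] using h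

theorem completeHomogeneous_const (n k : ℕ) (c : ℝ) :
    completeHomogeneous k (fun _ : Fin n => c) = (n.multichoose k : ℝ) * c ^ k := by
  simp [completeHomogeneous, Sym.card_sym_eq_multichoose]

/-- Monotone tuples with values in `Fin n` correspond to multisets. -/
theorem bijective_monotone_toSym (n k : ℕ) :
    Function.Bijective (fun j : {j : Fin k → Fin n // Monotone j} =>
      (⟨(List.ofFn j.1 : Multiset (Fin n)), by simp⟩ : Sym (Fin n) k)) := by
  constructor
  · intro j j' h
    have h1 : (List.ofFn j.1).Perm (List.ofFn j'.1) := by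
      simpa [Subtype.ext_iff] using h
    exact Subtype.ext (List.ofFn_injective
      (h1.eq_of_pairwise' j.2.sortedLE_ofFn.pairwise j'.2.sortedLE_ofFn.pairwise))
  · rintro ⟨s, rfl⟩
    have hl : (s.sort).length = s.card := s.length_sort (· ≤ ·)
    refine ⟨⟨fun i => s.sort.get (i.cast hl.symm), fun a b hab => ?_⟩, ?_⟩
    · exact (s.pairwise_sort (· ≤ ·)).sortedLE.monotone_get hab
    · apply Subtype.ext
      conv_rhs => rw [← s.sort_eq (· ≤ ·)]
      simp only [Multiset.coe_eq_coe]
      refine List.Perm.of_eq (List.ext_get (by simp) fun i h1 h2 => by simp)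

open Classical in
theorem sum_monotone_prod {n k : ℕ} (x : Fin n → ℝ) :
    ∑ j : {j : Fin k → Fin n // Monotone j}, ∏ i, x (j.1 i) = completeHomogeneous k x := by
  rw [completeHomogeneous]
  refine Fintype.sum_bijective (κ := Sym (Fin n) k) _ (bijective_monotone_toSym n k) _ _
    fun j => ?_
  change _ = (Multiset.map x (List.ofFn j.1 : Multiset (Fin n))).prod
  simp [List.prod_ofFn, Function.comp_def]

/-! ### Polarization and multilinear forms. -/

/-- A subspace containing all powers `(f + c g) ^ d` contains all monomials `f ^ (d - k) g ^ k`. -/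
theorem monomial_mem_span_pow {R : Type*} [CommRing R] [Algebra ℝ R] (f g : R) (d k : ℕ)
    (hk : k ≤ d) :
    f ^ (d - k) * g ^ k ∈ Submodule.span ℝ (Set.range fun c : ℝ => (f + c • g) ^ d) := by
  by_contra hmem
  -- A functional `φ` kills all powers but not the monomial; expanding `φ ((f + c g) ^ d)` in `c`
  -- gives a polynomial that vanishes identically, so each of its coefficients is zero.
  obtain ⟨φ, hφ, hφW⟩ := Submodule.exists_dual_map_eq_bot_of_notMem hmem inferInstance
  let P : Polynomial ℝ := ∑ i ∈ Finset.range (d + 1),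
    Polynomial.monomial i ((d.choose i : ℝ) * φ (f ^ (d - i) * g ^ i))
  have hP : P = 0 := by
    refine Polynomial.funext fun c => ?_
    have h0 : φ ((f + c • g) ^ d) = 0 := by
      have : φ ((f + c • g) ^ d) ∈ Submodule.map φ
          (Submodule.span ℝ (Set.range fun c : ℝ => (f + c • g) ^ d)) :=
        Submodule.mem_map_of_mem (Submodule.subset_span ⟨c, rfl⟩)
      rwa [hφW, Submodule.mem_bot] at this
    rw [add_comm, add_pow, map_sum] at h0
    rw [Polynomial.eval_zero, ← h0, Polynomial.eval_finsetSum]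
    refine Finset.sum_congr rfl fun i _ => ?_
    have : (c • g) ^ i * f ^ (d - i) * ((d.choose i : ℕ) : R)
        = ((d.choose i : ℝ) * c ^ i) • (f ^ (d - i) * g ^ i) := by
      rw [smul_pow, mul_smul, Nat.cast_smul_eq_nsmul, nsmul_eq_mul, smul_mul_assoc,
        smul_mul_assoc, mul_smul_comm]
      congr 1
      ring
    rw [this, map_smul, Polynomial.eval_monomial, smul_eq_mul]
    ring
  have hc : P.coeff k = (d.choose k : ℝ) * φ (f ^ (d - k) * g ^ k) := by
    simp [P, Polynomial.coeff_monomial, Nat.lt_succ_of_le hk]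
  rw [hP, Polynomial.coeff_zero] at hc
  have := Nat.choose_pos hk
  rcases mul_eq_zero.1 hc.symm with h | h
  · exact this.ne' (by exact_mod_cast h)
  · exact hφ h

theorem exists_sum_pow_of_mem_piSpace {γ₁ γ₂ : ℝ → ℝ} {A B : ℝ} {d : ℕ} {G : ℝ → ℝ}
    (hG : G ∈ piSpace γ₁ γ₂ A B d) :
    ∃ w : ℝ →₀ ℝ, ∀ x ∈ Set.Icc A B,
      G x = ∑ c ∈ w.support, w c * (γ₁ x + c * γ₂ x) ^ d := by
  obtain ⟨H, hH, hGH⟩ := hG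
  have h : H ∈ Submodule.span ℝ (Set.range fun c : ℝ => (γ₁ + c • γ₂) ^ d) := by
    refine Submodule.span_le.2 ?_ hH
    rintro _ ⟨k, rfl⟩
    exact monomial_mem_span_pow γ₁ γ₂ d k (Nat.le_of_lt_succ k.2)
  obtain ⟨w, rfl⟩ := Finsupp.mem_span_range_iff_exists_finsupp.1 h
  refine ⟨w, fun x hx => ?_⟩
  rw [hGH hx]
  simp [Finsupp.sum]

/-- A symmetric multilinear form vanishing at all `(a + t b, …, a + t b)` for infinitely many `t`
vanishes on all tuples with entries in `{a, b}`. -/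
theorem MultilinearMap.map_piecewise_eq_zero_of_infinite {V : Type*} [AddCommGroup V] [Module ℝ V]
    {k : ℕ} (h : MultilinearMap ℝ (fun _ : Fin k => V) ℝ)
    (hsymm : ∀ (σ : Equiv.Perm (Fin k)) (v : Fin k → V), h (fun i => v (σ i)) = h v)
    (a b : V) {T : Set ℝ} (hT : T.Infinite) (hz : ∀ t ∈ T, h (fun _ => a + t • b) = 0)
    (S : Finset (Fin k)) :
    h (S.piecewise (fun _ => b) (fun _ => a)) = 0 := by
  let P : Polynomial ℝ := ∑ S : Finset (Fin k),
    Polynomial.monomial S.card (h (S.piecewise (fun _ => b) (fun _ => a)))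
  have hP : P = 0 := by
    refine Polynomial.eq_zero_of_infinite_isRoot P (hT.mono fun t ht => ?_)
    have h0 := hz t ht
    have : (fun _ : Fin k => a + t • b) = (fun _ => t • b) + (fun _ => a) := by
      ext; simp [add_comm]
    rw [this, h.map_add_univ] at h0
    change P.eval t = 0
    rw [← h0, Polynomial.eval_finsetSum]
    refine Finset.sum_congr rfl fun S _ => ?_
    have h2 := h.map_piecewise_smul (fun _ => t) (S.piecewise (fun _ => b) (fun _ => a)) S
    have h3 : S.piecewise (fun i => t • S.piecewise (fun _ => b) (fun _ => a) i)
        (S.piecewise (fun _ => b) (fun _ => a)) = S.piecewise (fun _ => t • b) (fun _ => a) := by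
      ext i; by_cases hi : i ∈ S <;> simp [hi]
    rw [h3] at h2
    rw [h2, Polynomial.eval_monomial]
    simp [mul_comm]
  -- By symmetry the value depends only on the cardinality of `S`, so a coefficient is a positive
  -- count times a single value.
  have hc : P.coeff S.card = ((Finset.univ.filter fun S' : Finset (Fin k) =>
      S'.card = S.card).card : ℝ) * h (S.piecewise (fun _ => b) (fun _ => a)) := by
    simp only [P, Polynomial.finsetSum_coeff, Polynomial.coeff_monomial]
    rw [← Finset.sum_filter, ← nsmul_eq_mul, ← Finset.sum_const]
    refine Finset.sum_congr rfl fun S' hS' => ?_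
    have hcard : S'.card = S.card := (Finset.mem_filter.1 hS').2
    obtain ⟨e⟩ : Nonempty (S' ≃ S) := ⟨Finset.equivOfCardEq hcard⟩
    rw [← hsymm (e.extendSubtype) (S.piecewise (fun _ => b) (fun _ => a))]
    congr 1
    ext i
    by_cases hi : i ∈ S'
    · have := e.extendSubtype_mem i hi
      simp [hi, this]
    · have := e.extendSubtype_not_mem i hi
      simp [hi, this]
  rw [hP, Polynomial.coeff_zero] at hc
  refine (mul_eq_zero.1 hc.symm).resolve_left ?_
  have : 0 < (Finset.univ.filter fun S' : Finset (Fin k) => S'.card = S.card).card :=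
    Finset.card_pos.2 ⟨S, by simp⟩
  exact_mod_cast this.ne'

/-- A multilinear form vanishing on all tuples with entries in a spanning pair is zero. -/
theorem MultilinearMap.eq_zero_of_map_piecewise {V : Type*} [AddCommGroup V] [Module ℝ V]
    {k : ℕ} (h : MultilinearMap ℝ (fun _ : Fin k => V) ℝ) (a b : V)
    (hspan : ∀ v, ∃ p q : ℝ, v = p • b + q • a)
    (hz : ∀ S : Finset (Fin k), h (S.piecewise (fun _ => b) (fun _ => a)) = 0) : h = 0 := by
  ext v
  choose p q hpq using fun i => hspan (v i)
  have hv : v = (fun i => p i • b) + (fun i => q i • a) := funext hpq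
  rw [hv, h.map_add_univ]
  refine Finset.sum_eq_zero fun S _ => ?_
  have h3 : S.piecewise (fun i => p i • b) (fun i => q i • a)
      = fun i => S.piecewise p q i • S.piecewise (fun _ => b) (fun _ => a) i := by
    ext i; by_cases hi : i ∈ S <;> simp [hi]
  rw [h3, h.map_smul_univ, hz, smul_zero]

/-! ### Generalized derivatives and divided differences. -/

section
variable {γ₁ γ₂ : ℝ → ℝ} {A B : ℝ}

theorem neBot_nhdsWithin_Icc_diff (hAB : A < B) {x₀ : ℝ} (hx₀ : x₀ ∈ Set.Icc A B) :
    (𝓝[Set.Icc A B \ {x₀}] x₀).NeBot :=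
  accPt_principal_iff_nhdsWithin.1
    (uniqueDiffWithinAt_iff_accPt.1 (uniqueDiffOn_Icc hAB x₀ hx₀))

theorem HasGenDerivAt.genDeriv_eq (hAB : A < B) {f : ℝ → ℝ} {L x₀ : ℝ} (hx₀ : x₀ ∈ Set.Icc A B)
    (h : HasGenDerivAt γ₁ γ₂ A B f L x₀) : genDeriv γ₁ γ₂ A B f x₀ = L :=
  haveI := neBot_nhdsWithin_Icc_diff hAB hx₀
  Tendsto.limUnder_eq h

theorem HasGenDerivAt.congr {f g : ℝ → ℝ} {L x₀ : ℝ} (hx₀ : x₀ ∈ Set.Icc A B)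
    (h : HasGenDerivAt γ₁ γ₂ A B f L x₀) (hfg : Set.EqOn g f (Set.Icc A B)) :
    HasGenDerivAt γ₁ γ₂ A B g L x₀ := by
  refine Tendsto.congr' ?_ h
  filter_upwards [self_mem_nhdsWithin] with x hx
  rw [hfg hx.1, hfg hx₀]

theorem HasGenDerivAt.const_mul {f : ℝ → ℝ} {L x₀ : ℝ} (c : ℝ)
    (h : HasGenDerivAt γ₁ γ₂ A B f L x₀) :
    HasGenDerivAt γ₁ γ₂ A B (fun x => c * f x) (c * L) x₀ := by
  refine (Tendsto.const_mul c h).congr fun x => ?_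
  ring

theorem HasGenDerivAt.sum {ι : Type*} (s : Finset ι) {f : ι → ℝ → ℝ} {L : ι → ℝ} {x₀ : ℝ}
    (h : ∀ i ∈ s, HasGenDerivAt γ₁ γ₂ A B (f i) (L i) x₀) :
    HasGenDerivAt γ₁ γ₂ A B (fun x => ∑ i ∈ s, f i x) (∑ i ∈ s, L i) x₀ := by
  refine (tendsto_finsetSum s h).congr fun x => ?_
  rw [← Finset.sum_div, Finset.sum_sub_distrib]

/-- A continuous function whose increments are proportional to the bracket has powers that are
differentiable in the generalized sense. -/
theorem hasGenDerivAt_pow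
    (hd : ∀ x ∈ Set.Icc A B, ∀ y ∈ Set.Icc A B, x ≠ y → bracket γ₁ γ₂ x y ≠ 0)
    {l : ℝ → ℝ} {r : ℝ} (hl : ContinuousOn l (Set.Icc A B))
    (hr : ∀ x ∈ Set.Icc A B, ∀ y ∈ Set.Icc A B, l y - l x = r * bracket γ₁ γ₂ x y)
    (N : ℕ) {x₀ : ℝ} (hx₀ : x₀ ∈ Set.Icc A B) :
    HasGenDerivAt γ₁ γ₂ A B (fun x => l x ^ N) (N * r * l x₀ ^ (N - 1)) x₀ := by
  have ht : Tendsto l (𝓝[Set.Icc A B \ {x₀}] x₀) (𝓝 (l x₀)) :=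
    (hl x₀ hx₀).mono_left (nhdsWithin_mono _ Set.sdiff_subset)
  have hsum : Tendsto
      (fun x => r * ∑ i ∈ Finset.range N, l x ^ i * l x₀ ^ (N - 1 - i))
      (𝓝[Set.Icc A B \ {x₀}] x₀)
      (𝓝 (r * ∑ i ∈ Finset.range N, l x₀ ^ i * l x₀ ^ (N - 1 - i))) :=
    Tendsto.const_mul r (tendsto_finsetSum _ fun i _ => (ht.pow i).mul_const _)
  rw [geom_sum₂_self] at hsum
  rw [show (N : ℝ) * r * l x₀ ^ (N - 1) = r * (N * l x₀ ^ (N - 1)) by ring]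
  refine Tendsto.congr' ?_ hsum
  filter_upwards [self_mem_nhdsWithin] with x hx
  rw [eq_div_iff (hd x₀ hx₀ x hx.1 (Ne.symm hx.2)), ← geom_sum₂_mul, hr x₀ hx₀ x hx.1]
  ring

/-- On the line `α u + β v = 1` the bracket is a difference of parameters, so `d(y, x) - d(a, x) =
-d(a, y)`. -/
theorem HasGenDerivAt.bracket_left
    (hd : ∀ x ∈ Set.Icc A B, ∀ y ∈ Set.Icc A B, x ≠ y → bracket γ₁ γ₂ x y ≠ 0)
    {α β : ℝ} (hone : ∀ x ∈ Set.Icc A B, α * γ₁ x + β * γ₂ x = 1)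
    {a x : ℝ} (ha : a ∈ Set.Icc A B) (hx : x ∈ Set.Icc A B) :
    HasGenDerivAt γ₁ γ₂ A B (fun s => bracket γ₁ γ₂ s x) (-1) a := by
  refine tendsto_const_nhds.congr' ?_
  filter_upwards [self_mem_nhdsWithin] with y hy
  rw [eq_div_iff (hd a ha y hy.1 (Ne.symm hy.2))]
  have h1 := hone a ha
  have h2 := hone x hx
  have h3 := hone y hy.1
  simp only [bracket]
  linear_combination (γ₂ x * γ₁ y - γ₁ x * γ₂ y) * h1 + (γ₂ y * γ₁ a - γ₁ y * γ₂ a) * h2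
    + (γ₂ a * γ₁ x - γ₁ a * γ₂ x) * h3

theorem linear_sub_eq_mul_bracket
    {α β : ℝ} (hone : ∀ x ∈ Set.Icc A B, α * γ₁ x + β * γ₂ x = 1) (c : ℝ)
    {x y : ℝ} (hx : x ∈ Set.Icc A B) (hy : y ∈ Set.Icc A B) :
    (γ₁ y + c * γ₂ y) - (γ₁ x + c * γ₂ x) = (c * α - β) * bracket γ₁ γ₂ x y := by
  have h1 := hone x hx
  have h2 := hone y hy
  simp only [bracket]
  linear_combination (-(γ₁ y + c * γ₂ y)) * h1 + (γ₁ x + c * γ₂ x) * h2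

section PowerSum

variable {ι : Type*} {T : Finset ι} {d : ℕ} {l : ι → ℝ → ℝ} {r : ι → ℝ}

/-- The `i`-th generalized derivative of a linear combination of `d`-th powers. -/
theorem iterate_genDeriv_sum_pow (hAB : A < B)
    (hd : ∀ x ∈ Set.Icc A B, ∀ y ∈ Set.Icc A B, x ≠ y → bracket γ₁ γ₂ x y ≠ 0)
    (hl : ∀ c, ContinuousOn (l c) (Set.Icc A B))
    (hr : ∀ c, ∀ x ∈ Set.Icc A B, ∀ y ∈ Set.Icc A B, l c y - l c x = r c * bracket γ₁ γ₂ x y)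
    {w : ι → ℝ} {f : ℝ → ℝ} (hf : ∀ x ∈ Set.Icc A B, f x = ∑ c ∈ T, w c * l c x ^ d) (i : ℕ) :
    (∀ x ∈ Set.Icc A B, (genDeriv γ₁ γ₂ A B)^[i] f x
      = ∑ c ∈ T, w c * (d.descFactorial i * r c ^ i) * l c x ^ (d - i)) ∧
    ∀ x ∈ Set.Icc A B, HasGenDerivAt γ₁ γ₂ A B ((genDeriv γ₁ γ₂ A B)^[i] f)
      (∑ c ∈ T, w c * (d.descFactorial (i + 1) * r c ^ (i + 1)) * l c x ^ (d - (i + 1))) x := by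
  -- For `i ≥ d` the exponent `d - (i + 1)` truncates harmlessly, because `d.descFactorial (i + 1) =
  -- 0`.
  have key : ∀ i : ℕ, (∀ x ∈ Set.Icc A B, (genDeriv γ₁ γ₂ A B)^[i] f x
      = ∑ c ∈ T, w c * (d.descFactorial i * r c ^ i) * l c x ^ (d - i)) →
      ∀ x ∈ Set.Icc A B, HasGenDerivAt γ₁ γ₂ A B ((genDeriv γ₁ γ₂ A B)^[i] f)
      (∑ c ∈ T, w c * (d.descFactorial (i + 1) * r c ^ (i + 1)) * l c x ^ (d - (i + 1))) x := by
    intro i hi x hx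
    have h := HasGenDerivAt.sum T fun c _ =>
      (hasGenDerivAt_pow hd (hl c) (hr c) (d - i) hx).const_mul
        (w c * (d.descFactorial i * r c ^ i))
    convert h.congr hx hi using 1
    refine Finset.sum_congr rfl fun c _ => ?_
    rw [Nat.descFactorial_succ, Nat.sub_sub]
    push_cast
    ring
  induction i with
  | zero =>
    have h0 : ∀ x ∈ Set.Icc A B, (genDeriv γ₁ γ₂ A B)^[0] f x
      = ∑ c ∈ T, w c * (d.descFactorial 0 * r c ^ 0) * l c x ^ (d - 0) := by simpa using hf
    exact ⟨h0, key 0 h0⟩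
  | succ i ih =>
    have h1 : ∀ x ∈ Set.Icc A B, (genDeriv γ₁ γ₂ A B)^[i + 1] f x
      = ∑ c ∈ T, w c * (d.descFactorial (i + 1) * r c ^ (i + 1)) * l c x ^ (d - (i + 1)) := by
      intro x hx
      rw [Function.iterate_succ_apply']
      exact (ih.2 x hx).genDeriv_eq hAB hx
    exact ⟨h1, key _ h1⟩

/-- Divided differences of a linear combination of `d`-th powers are linear combinations of
complete homogeneous symmetric sums. -/
theorem divDiff_sum_pow (hAB : A < B)
    (hd : ∀ x ∈ Set.Icc A B, ∀ y ∈ Set.Icc A B, x ≠ y → bracket γ₁ γ₂ x y ≠ 0)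
    (hl : ∀ c, ContinuousOn (l c) (Set.Icc A B))
    (hr : ∀ c, ∀ x ∈ Set.Icc A B, ∀ y ∈ Set.Icc A B, l c y - l c x = r c * bracket γ₁ γ₂ x y)
    {w : ι → ℝ} {f : ℝ → ℝ} (hf : ∀ x ∈ Set.Icc A B, f x = ∑ c ∈ T, w c * l c x ^ d)
    {m : ℕ} (hm : m ≤ d) (ε : Fin (m + 1) → ℝ) (hε : ∀ i, ε i ∈ Set.Icc A B) :
    divDiff γ₁ γ₂ A B f m ε
      = ∑ c ∈ T, w c * r c ^ m * completeHomogeneous (d - m) (fun i => l c (ε i)) := by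
  induction m with
  | zero =>
    rw [divDiff, hf _ (hε 0)]
    refine Finset.sum_congr rfl fun c _ => ?_
    have : (fun i => l c (ε i)) = fun _ : Fin (0 + 1) => l c (ε 0) := by
      ext i; rw [show i = 0 from Fin.fin_one_eq_zero i]
    rw [this, completeHomogeneous_const]
    simp
  | succ m ih =>
    rw [divDiff]
    split_ifs with h
    · set p := (Finset.univ.filter fun i => ε i ≠ ε (Fin.last (m + 1))).max' h with hp
      have hpne : ε p ≠ ε (Fin.last (m + 1)) :=
        (Finset.mem_filter.1 (Finset.max'_mem _ h)).2
      rw [ih (by omega) _ fun i => hε _, ih (by omega) _ fun i => hε _,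
        div_eq_iff (hd _ (hε p) _ (hε _) hpne), ← Finset.sum_sub_distrib, Finset.sum_mul]
      refine Finset.sum_congr rfl fun c _ => ?_
      obtain ⟨k, rfl⟩ : ∃ k, d = m + 1 + k := ⟨d - (m + 1), by omega⟩
      rw [show m + 1 + k - m = k + 1 by omega, show m + 1 + k - (m + 1) = k by omega]
      -- Splitting off `p` and splitting off the last node expand the same sum; subtracting leaves
      -- the increment of `l c` times the sum of degree `k`.
      have h1 := completeHomogeneous_succAbove k (fun i => l c (ε i)) p
      have h2 := completeHomogeneous_succAbove k (fun i => l c (ε i)) (Fin.last (m + 1))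
      have h3 := hr c _ (hε p) _ (hε (Fin.last (m + 1)))
      simp only [Fin.succAbove_last] at h2
      linear_combination (w c * r c ^ m) * (h2 - h1
        + completeHomogeneous k (fun i => l c (ε i)) * h3)
    · have hconst : ∀ i, ε i = ε 0 := by
        have h' : ∀ i, ε i = ε (Fin.last (m + 1)) := fun i => by
          by_contra hi
          exact h ⟨i, by simpa using hi⟩
        intro i
        rw [h' i, h' 0]
      rw [(iterate_genDeriv_sum_pow hAB hd hl hr hf (m + 1)).1 _ (hε 0), Finset.sum_div]
      refine Finset.sum_congr rfl fun c _ => ?_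
      simp only [hconst, completeHomogeneous_const]
      -- With `m + 2` equal nodes the homogeneous sum has `d.choose (m + 1)` terms, which is
      -- `d.descFactorial (m + 1) / (m + 1)!`.
      rw [Nat.multichoose_eq, show m + 1 + 1 + (d - (m + 1)) - 1 = d by omega,
        Nat.choose_symm hm, Nat.descFactorial_eq_factorial_mul_choose]
      have := Nat.factorial_ne_zero (m + 1)
      push_cast
      field_simp

end PowerSum

end

/-! ### Blossoms: existence and uniqueness. -/

/-- The linear form `(u, v) ↦ u + c v` on the plane. -/
noncomputable def planeForm (c : ℝ) : ℝ × ℝ →ₗ[ℝ] ℝ :=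
  LinearMap.fst ℝ ℝ ℝ + c • LinearMap.snd ℝ ℝ ℝ

/-- The symmetric multilinear form `∑ c, z c * ∏ i, (u i + c v i)`. -/
noncomputable def powerSumBlossom (k : ℕ) (T : Finset ℝ) (z : ℝ → ℝ) :
    MultilinearMap ℝ (fun _ : Fin k => ℝ × ℝ) ℝ :=
  ∑ c ∈ T, z c • (MultilinearMap.mkPiAlgebra ℝ (Fin k) ℝ).compLinearMap fun _ => planeForm c

theorem powerSumBlossom_apply (k : ℕ) (T : Finset ℝ) (z : ℝ → ℝ) (v : Fin k → ℝ × ℝ) :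
    powerSumBlossom k T z v = ∑ c ∈ T, z c * ∏ i, ((v i).1 + c * (v i).2) := by
  simp [powerSumBlossom, planeForm]

theorem isBlossom_powerSumBlossom {γ₁ γ₂ : ℝ → ℝ} {A B : ℝ} {k : ℕ} {T : Finset ℝ} {z : ℝ → ℝ}
    {F : ℝ → ℝ} (hF : ∀ x ∈ Set.Icc A B, F x = ∑ c ∈ T, z c * (γ₁ x + c * γ₂ x) ^ k) :
    IsBlossom γ₁ γ₂ A B k F (powerSumBlossom k T z) where
  symm σ v := by
    simp only [powerSumBlossom_apply]
    refine Finset.sum_congr rfl fun c _ => ?_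
    rw [Equiv.prod_comp σ fun i => (v i).1 + c * (v i).2]
  diag x hx := by
    simp [powerSumBlossom_apply, hF x hx]

theorem blossomSum_powerSumBlossom (γ₁ γ₂ : ℝ → ℝ) {n k : ℕ} (ε : Fin n → ℝ) (T : Finset ℝ)
    (z : ℝ → ℝ) :
    blossomSum γ₁ γ₂ ε (powerSumBlossom k T z)
      = ∑ c ∈ T, z c * completeHomogeneous k (fun i => γ₁ (ε i) + c * γ₂ (ε i)) := by
  simp only [blossomSum, powerSumBlossom_apply]
  rw [Finset.sum_comm]
  refine Finset.sum_congr rfl fun c _ => ?_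
  rw [← Finset.mul_sum, ← sum_monotone_prod]

/-- Blossoms are unique. -/
theorem IsBlossom.unique {γ₁ γ₂ : ℝ → ℝ} {A B : ℝ} (hAB : A < B)
    (hd : ∀ x ∈ Set.Icc A B, ∀ y ∈ Set.Icc A B, x ≠ y → bracket γ₁ γ₂ x y ≠ 0)
    {α β : ℝ} (hone : ∀ x ∈ Set.Icc A B, α * γ₁ x + β * γ₂ x = 1) {k : ℕ} {F : ℝ → ℝ}
    {g g' : MultilinearMap ℝ (fun _ : Fin k => ℝ × ℝ) ℝ}
    (hg : IsBlossom γ₁ γ₂ A B k F g) (hg' : IsBlossom γ₁ γ₂ A B k F g') : g' = g := by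
  have hA : A ∈ Set.Icc A B := Set.left_mem_Icc.2 hAB.le
  -- `(-β, α)` directs the line `α u + β v = 1`, and the bracket with `A` is the parameter along it.
  have hcurve : ∀ x ∈ Set.Icc A B,
      ((γ₁ A, γ₂ A) : ℝ × ℝ) + bracket γ₁ γ₂ A x • ((-β, α) : ℝ × ℝ) = (γ₁ x, γ₂ x) := by
    intro x hx
    have h1 := hone A hA
    have h2 := hone x hx
    ext
    · simp only [bracket, Prod.fst_add, Prod.smul_fst, smul_eq_mul]
      linear_combination (γ₁ x) * h1 - (γ₁ A) * h2
    · simp only [bracket, Prod.snd_add, Prod.smul_snd, smul_eq_mul]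
      linear_combination (γ₂ x) * h1 - (γ₂ A) * h2
  have hinj : Set.InjOn (fun x => bracket γ₁ γ₂ A x) (Set.Icc A B) := by
    intro x hx y hy hxy
    by_contra hne
    refine hd x hx y hy hne ?_
    have hx' := hcurve x hx
    rw [show bracket γ₁ γ₂ A x = bracket γ₁ γ₂ A y from hxy, hcurve y hy] at hx'
    obtain ⟨h1, h2⟩ := Prod.ext_iff.1 hx'
    simp only at h1 h2
    rw [bracket, h1, h2]
    ring
  have hT : ((fun x => bracket γ₁ γ₂ A x) '' Set.Icc A B).Infinite :=
    (Set.Icc_infinite hAB).image hinj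
  refine sub_eq_zero.1 (MultilinearMap.eq_zero_of_map_piecewise (g' - g)
    ((γ₁ A, γ₂ A) : ℝ × ℝ) ((-β, α) : ℝ × ℝ) (fun v => ?_)
    (MultilinearMap.map_piecewise_eq_zero_of_infinite _ (fun σ v => ?_) _ _ hT ?_))
  -- Cramer's rule: the base point and the direction have determinant `α γ₁(A) + β γ₂(A) = 1`.
  · refine ⟨γ₁ A * v.2 - γ₂ A * v.1, α * v.1 + β * v.2, ?_⟩
    have h1 := hone A hA
    ext
    · simp only [Prod.fst_add, Prod.smul_fst, smul_eq_mul]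
      linear_combination (-v.1) * h1
    · simp only [Prod.snd_add, Prod.smul_snd, smul_eq_mul]
      linear_combination (-v.2) * h1
  · simp only [sub_apply, hg.symm, hg'.symm]
  · rintro _ ⟨x, hx, rfl⟩
    simp only [hcurve x hx, sub_apply, hg.diag x hx, hg'.diag x hx, sub_self]

/-! ### The main theorem. -/

/-- Here `n = m + 1` is the number of nodes, and `genDeriv … (fun s => bracket γ₁ γ₂ s x) a` is
`D_{γ₁,γ₂} d(a, x)`, the generalized derivative being taken in the variable `a`. -/
theorem mainTheorem1 (γ₁ γ₂ : ℝ → ℝ) (A B : ℝ) (hAB : A < B)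
    (hγ₁ : ContinuousOn γ₁ (Set.Icc A B)) (hγ₂ : ContinuousOn γ₂ (Set.Icc A B))
    (hd : ∀ x ∈ Set.Icc A B, ∀ y ∈ Set.Icc A B, x ≠ y → bracket γ₁ γ₂ x y ≠ 0)
    (hone : ∃ α β : ℝ, ∀ x ∈ Set.Icc A B, α * γ₁ x + β * γ₂ x = 1)
    (d m : ℕ) (hm : m ≤ d) (G : ℝ → ℝ) (hG : G ∈ piSpace γ₁ γ₂ A B d) :
    -- the derivatives `D G, …, D ^ m G` exist on `[A, B]`
    (∀ i < m, ∀ x ∈ Set.Icc A B,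
      HasGenDerivAt γ₁ γ₂ A B ((genDeriv γ₁ γ₂ A B)^[i] G)
        ((genDeriv γ₁ γ₂ A B)^[i + 1] G x) x) ∧
    -- the derivative of `d(a, x)` in `a` exists on `[A, B]`
    (∀ a ∈ Set.Icc A B, ∀ x ∈ Set.Icc A B,
      HasGenDerivAt γ₁ γ₂ A B (fun s => bracket γ₁ γ₂ s x)
        (genDeriv γ₁ γ₂ A B (fun s => bracket γ₁ γ₂ s x) a) a) ∧
    -- `D ^ m G` has a unique blossom with `d - m` arguments, and the two formulas hold for it
    ∃ g : MultilinearMap ℝ (fun _ : Fin (d - m) => ℝ × ℝ) ℝ,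
      IsBlossom γ₁ γ₂ A B (d - m) ((genDeriv γ₁ γ₂ A B)^[m] G) g ∧
      (∀ g' : MultilinearMap ℝ (fun _ : Fin (d - m) => ℝ × ℝ) ℝ,
        IsBlossom γ₁ γ₂ A B (d - m) ((genDeriv γ₁ γ₂ A B)^[m] G) g' → g' = g) ∧
      ∀ ε : Fin (m + 1) → ℝ, (∀ i, ε i ∈ Set.Icc A B) →
        (∀ a ∈ Set.Icc A B, ∀ x ∈ Set.Icc A B,
          divDiff γ₁ γ₂ A B
              (fun t => genDeriv γ₁ γ₂ A B (fun s => bracket γ₁ γ₂ s t) a ^ m * G t) m ε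
            = genDeriv γ₁ γ₂ A B (fun s => bracket γ₁ γ₂ s x) a ^ m
              * (((d - m).factorial : ℝ) / (d.factorial : ℝ)) * blossomSum γ₁ γ₂ ε g) ∧
        divDiff γ₁ γ₂ A B G m ε
          = (((d - m).factorial : ℝ) / (d.factorial : ℝ)) * blossomSum γ₁ γ₂ ε g := by
  obtain ⟨α, β, hone⟩ := hone
  obtain ⟨w, hw⟩ := exists_sum_pow_of_mem_piSpace hG
  let l : ℝ → ℝ → ℝ := fun c x => γ₁ x + c * γ₂ x
  let r : ℝ → ℝ := fun c => c * α - β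
  have hl : ∀ c, ContinuousOn (l c) (Set.Icc A B) := fun c =>
    hγ₁.add (continuousOn_const.mul hγ₂)
  have hr : ∀ c, ∀ x ∈ Set.Icc A B, ∀ y ∈ Set.Icc A B,
      l c y - l c x = r c * bracket γ₁ γ₂ x y :=
    fun c x hx y hy => linear_sub_eq_mul_bracket hone c hx hy
  have hbr : ∀ a ∈ Set.Icc A B, ∀ x ∈ Set.Icc A B,
      genDeriv γ₁ γ₂ A B (fun s => bracket γ₁ γ₂ s x) a = -1 := fun a ha x hx =>
    (HasGenDerivAt.bracket_left hd hone ha hx).genDeriv_eq hAB ha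
  have hiter := iterate_genDeriv_sum_pow (l := l) (r := r) hAB hd hl hr hw
  have hfact : ((d - m).factorial : ℝ) / d.factorial * d.descFactorial m = 1 := by
    rw [div_mul_eq_mul_div, div_eq_one_iff_eq (by positivity)]
    exact_mod_cast Nat.factorial_mul_descFactorial hm
  refine ⟨fun i _ x hx => ?_, fun a ha x hx => ?_,
    powerSumBlossom (d - m) w.support fun c => w c * (d.descFactorial m * r c ^ m), ?_, ?_, ?_⟩
  · rw [(hiter (i + 1)).1 x hx]
    exact (hiter i).2 x hx
  · rw [hbr a ha x hx]
    exact HasGenDerivAt.bracket_left hd hone ha hx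
  · exact isBlossom_powerSumBlossom (hiter m).1
  · exact fun g' hg' => IsBlossom.unique hAB hd hone (isBlossom_powerSumBlossom (hiter m).1) hg'
  · intro ε hε
    rw [blossomSum_powerSumBlossom]
    refine ⟨fun a ha x hx => ?_, ?_⟩
    -- The constant factor `(-1) ^ m` is absorbed into the weights.
    · rw [divDiff_sum_pow (l := l) (r := r) (T := w.support)
        (w := fun c => (-1) ^ m * w c) hAB hd hl hr
        (fun t ht => by rw [hbr a ha t ht, hw t ht, Finset.mul_sum]; simp only [l, mul_assoc])
        hm ε hε, hbr a ha x hx, Finset.mul_sum]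
      refine Finset.sum_congr rfl fun c _ => ?_
      linear_combination (-((-1) ^ m * w c * r c ^ m
        * completeHomogeneous (d - m) fun i => l c (ε i))) * hfact
    · rw [divDiff_sum_pow (l := l) (r := r) hAB hd hl hr hw hm ε hε, Finset.mul_sum]
      refine Finset.sum_congr rfl fun c _ => ?_
      linear_combination (-(w c * r c ^ m
        * completeHomogeneous (d - m) fun i => l c (ε i))) * hfact
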